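/- Let $G=(V,E)$ be a finite graph, with one (unordered) edge $\{i,j\}$ for each adjacent pair of distinct vertices (for instance the complete graph on $V$), and let $X=V\cup E$ be partially ordered by $v\le e$ whenever $v$ is an endpoint of $e$. For $A\subseteq X$ put $\operatorname{cl}(A)=\{x\in X:\exists a\in A,\ x\le a\}$. A relation matrix is an arbitrary real matrix $W=(W(i,j))_{i,j\in V}$. For $\lambda\in\mathbb R$ let $\mathcal V_\lambda(W)$ be the graph multivector field at threshold $\lambda$: the finest partition of $X$ into blocks such that, for every edge $\{i,j\}$, the vertex $i$ and the edge $\{i,j\}$ lie in the same block whenever $W(i,j)>\lambda$ (and likewise $j$ and $\{i,j\}$ whenever $W(j,i)>\lambda$). The $M$-graph of $\mathcal V_\lambda(W)$ is the directed graph on the blocks with an arrow $A\to B$ whenever $B\cap(A\cup\operatorname{cl}(A))\neq\emptyset$. The Morse sets at threshold $\lambda$ are the strongly connected components of this graph, each regarded as the subset of $X$ that is the union of its blocks. The filtration is indexed by the real interval $\Lambda_W=[\min_{i\ne j}W(i,j),\ \max_{i\neq j}W(i,j)]$ (if $|V|\le 1$, all diagrams below are empty). For a set $M\subseteq X$ which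 is a Morse set at some threshold in $\Lambda_W$, its birth $\lambda_b$ and its death $\lambda_d$ are the supremum and the infimum of the $\lambda\in\Lambda_W$ at which $M$ is a Morse set; thus, as $\lambda$ decreases, $M$ appears at $\lambda_b$ and is merged into a larger Morse set at $\lambda_d$, and $\lambda_d$ is the smallest threshold if this never happens. The Morse persistence diagram $D_W$ is the multiset of the points $(\lambda_b,\lambda_d)$, one for each such $M$ with $\lambda_d<\lambda_b$ (points on the diagonal do not matter for the distance below). For finite multisets $D_1,D_2$ of points of $\mathbb R^2$, the bottleneck distance is $$d_B(D_1,D_2)=\inf_\eta\ \sup_{x}\ \|x-\eta(x)\|_\infty ,$$ where $\eta$ ranges over all bijections $D_1\cup\Delta\to D_2\cup\Delta$, $x$ ranges over $D_1\cup\Delta$, and $\Delta=\{(t,t):t\in\mathbb R\}$ is taken with countably infinite multiplicity. **Theorem (stability of Morse persistence diagrams).** Let $W$ and $W'$ be two relation matrices on the same finite graph $G$, and suppose that $\|W-W'\|_\infty=\sup_{i,j}|W(i,j)-W'(i,j)|\le\varepsilon$. Then $$d_B(D_W,D_{W'})\le\varepsilon .$$ -/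

import Mathlib

open scoped ENNReal

namespace MorsePersistence

universe u

section Graph

variable {V : Type u}

/-- The elements of the graph poset of `G`: the vertices and the (unordered) edges of `G`. -/
inductive Cell (G : SimpleGraph V) : Type u
  | vertex (v : V) : Cell G
  | edge (e : G.edgeSet) : Cell G

variable {G : SimpleGraph V}

/-- The face order: every vertex lies below each edge incident to it. -/
instance : PartialOrder (Cell G) where
  le x y := x = y ∨ ∃ v e, x = .vertex v ∧ y = .edge e ∧ v ∈ (e : Sym2 V)
  le_refl x := Or.inl rfl
  le_trans x y z := by
    rintro (rfl | ⟨v, e, rfl, rfl, h⟩) hyz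
    · exact hyz
    · rcases hyz with rfl | ⟨v', e', h', -, -⟩
      · exact Or.inr ⟨v, e, rfl, rfl, h⟩
      · cases h'
  le_antisymm x y := by
    rintro (rfl | ⟨v, e, rfl, rfl, h⟩) hyx
    · rfl
    · rcases hyx with h' | ⟨v', e', h', -, -⟩
      · exact h'.symm
      · cases h'

theorem Cell.le_def {x y : Cell G} :
    x ≤ y ↔ x = y ∨ ∃ v e, x = .vertex v ∧ y = .edge e ∧ v ∈ (e : Sym2 V) := Iff.rfl

instance [Finite V] : Finite (Cell G) := by
  have hf : Function.Injective
      (fun c : Cell G => (match c with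
        | .vertex v => Sum.inl v
        | .edge e => Sum.inr e : V ⊕ G.edgeSet)) := by
    intro x y h
    cases x <;> cases y <;> simp_all
  exact Finite.of_injective _ hf

/-- The graph poset has no chains of length two, so all its subsets are convex. -/
theorem Cell.ordConnected (A : Set (Cell G)) : A.OrdConnected := by
  refine ⟨fun x hx z hz y hy => ?_⟩
  rcases hy.1 with rfl | ⟨v, e, rfl, rfl, -⟩
  · exact hx
  · rcases hy.2 with rfl | ⟨v', e', h', -, -⟩
    · exact hz
    · cases h'

end Graph

section Poset

variable {X : Type u} [PartialOrder X]

/-- The closure of a subset of a finite poset, in the topology whose closed sets are the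
down-sets. -/
def cl (A : Set X) : Set X := {x | ∃ a ∈ A, x ≤ a}

variable (X) in
/-- A combinatorial multivector field: a partition (given by its equivalence relation) into
locally closed, i.e. convex, blocks. -/
structure MultivectorField extends Setoid X where
  convex : ∀ x, {y | toSetoid x y}.OrdConnected

namespace MultivectorField

variable (𝒱 : MultivectorField X)

/-- The multivectors, i.e. the blocks of the partition. -/
def multivectors : Set (Set X) := 𝒱.toSetoid.classes

/-- The image of a multivector under the multivalued map `Π x = [x] ∪ cl [x]`. -/
def image (A : Set X) : Set X := A ∪ cl A

/-- The `M`-graph: the nodes are the multivectors, with an arrow from `A` to `B` whenever `B`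
meets the image of `A`. -/
def MGraph : Digraph 𝒱.multivectors where
  Adj A B := ((B : Set X) ∩ image (A : Set X)).Nonempty

/-- There is a directed path (possibly of length zero) from `A` to `B` in the `M`-graph. -/
def Reaches (A B : 𝒱.multivectors) : Prop := Relation.ReflTransGen 𝒱.MGraph.Adj A B

/-- The strongly connected component of `A` in the `M`-graph, as a set of multivectors. -/
def scc (A : 𝒱.multivectors) : Set 𝒱.multivectors := {B | 𝒱.Reaches A B ∧ 𝒱.Reaches B A}

/-- The Morse sets: the strongly connected components of the `M`-graph, each one regarded as the
subset of `X` that is the union of its multivectors. -/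
def morseSets : Set (Set X) :=
  {M | ∃ A : 𝒱.multivectors, M = ⋃ B ∈ 𝒱.scc A, (B : Set X)}

end MultivectorField

end Poset

section Filtration

variable {V : Type u} (G : SimpleGraph V) (W : Matrix V V ℝ)

/-- The vertex `i` and the edge `{i, j}` are to be merged at threshold `t`: the relation from `i`
to `j` is active, i.e. `W i j > t`. -/
def Merge (t : ℝ) (x y : Cell G) : Prop :=
  ∃ (i j : V) (h : G.Adj i j), W i j > t ∧ x = .vertex i ∧ y = .edge ⟨s(i, j), h⟩

/-- The graph multivector field at threshold `t`: start from singletons, perform all active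
merges, and merge overlapping blocks transitively. -/
def field (t : ℝ) : MultivectorField (Cell G) where
  toSetoid := Relation.EqvGen.setoid (Merge G W t)
  convex _ := Cell.ordConnected _

/-- The critical thresholds: the off-diagonal entries of the relation matrix. -/
def critical : Set ℝ := {t | ∃ i j, i ≠ j ∧ W i j = t}

/-- The thresholds of the filtration: the interval from the smallest to the largest critical
value. -/
noncomputable def thresholds : Set ℝ := Set.Icc (sInf (critical W)) (sSup (critical W))

/-- The thresholds of the filtration at which `M` is a Morse set. -/
noncomputable def lifespan (M : Set (Cell G)) : Set ℝ :=
  {t ∈ thresholds W | M ∈ (field G W t).morseSets}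

/-- The birth of `M`: the filtration being scanned from large to small thresholds, this is where
`M` first appears. -/
noncomputable def birth (M : Set (Cell G)) : ℝ := sSup (lifespan G W M)

/-- The death of `M`: where it merges into a larger Morse set, or the smallest threshold of the
filtration if it never does. -/
noncomputable def death (M : Set (Cell G)) : ℝ := sInf (lifespan G W M)

/-- The Morse sets that appear along the filtration and have a positive lifetime. -/
def persistentMorseSets : Set (Set (Cell G)) :=
  {M | (lifespan G W M).Nonempty ∧ death G W M < birth G W M}

/-- The Morse persistence diagram: the multiset of the points `(birth, death)`, one for each Morse
set along the filtration. -/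
noncomputable def morseDiagram [Finite V] : Multiset (ℝ × ℝ) :=
  (Set.toFinite (persistentMorseSets G W)).toFinset.val.map fun M => (birth G W M, death G W M)

/-- The sup-norm distance of two relation matrices. -/
noncomputable def supDist (W W' : Matrix V V ℝ) : ℝ := ⨆ p : V × V, |W p.1 p.2 - W' p.1 p.2|

end Filtration

section Bottleneck

open Classical in
/-- The points of a diagram `D` with their multiplicities, together with infinitely many copies of
every point of the diagonal. -/
abbrev Augmented (D : Multiset (ℝ × ℝ)) : Type := D.ToType ⊕ (ℝ × ℕ)

open Classical in
/-- The point in the plane of an element of the augmented diagram. -/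
def Augmented.point {D : Multiset (ℝ × ℝ)} : Augmented D → ℝ × ℝ
  | .inl x => x.1
  | .inr t => (t.1, t.1)

/-- The bottleneck distance: the infimum, over all bijections between the two diagrams augmented
by the diagonal, of the largest displacement in the sup-norm of the plane (the distance of
`ℝ × ℝ`). -/
noncomputable def bottleneckDist (D₁ D₂ : Multiset (ℝ × ℝ)) : ℝ≥0∞ :=
  ⨅ η : Augmented D₁ ≃ Augmented D₂, ⨆ x : Augmented D₁, edist x.point (η x).point

end Bottleneck

end MorsePersistence

/-! The matching is the identity: a set `M` that persists for both matrices is paired with itself,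
and every other point goes to the diagonal. The Morse sets are the classes of mutual reachability,
so `M` is one at threshold `t` exactly when it is nonempty, its points are mutually reachable
(`connectedAt`), and no outside point is mutually reachable with a point of it (`isolatedAt`).
Lowering `t` only adds merges, so the first condition gives a lower set of thresholds and the second
an upper set. The lifespan is their intersection; its birth is the supremum of the lower set and its
death the infimum of the upper set (`birth_eq`, `death_eq`).

An entrywise change of at most `ε` moves each of these extrema by at most `ε`. If `M` persists for
both matrices, its two points are therefore `ε`-close. If it persists for one only, the extrema for
the other do not strictly overlap, so the lifetime is at most `2 * ε` and the point lies within `ε`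
of the diagonal (`EntrywiseClose.birth_sub_death_le`). `bottleneckDist_map_le` turns this partial
matching into a bijection of augmented diagrams. -/

namespace MorsePersistence

/-! ### From partial matchings to bijections of augmented diagrams. -/

section Bottleneck

variable {α : Type*}

/-- The elements of a finset correspond to those of the diagram it is mapped to. -/
theorem exists_equiv_toType_map [DecidableEq α] (S : Finset α) (f : α → ℝ × ℝ)
    [DecidableEq (ℝ × ℝ)] : ∃ e : S ≃ (S.val.map f).ToType, ∀ a, (e a).1 = f a := by
  have hb : Function.Bijective (fun v : S.val.ToType => (⟨v.1, Multiset.coe_mem⟩ : S)) := by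
    constructor
    · rintro ⟨a, i⟩ ⟨b, j⟩ h
      obtain rfl : a = b := congrArg Subtype.val h
      -- Without repetitions, the copy index has only the value `0`.
      have hc := Multiset.nodup_iff_count_le_one.1 S.nodup a
      have hij : i = j := Fin.ext (by have := i.2; have := j.2; omega)
      rw [hij]
    · rintro ⟨a, ha⟩
      exact ⟨⟨a, ⟨0, Multiset.count_pos.2 ha⟩⟩, rfl⟩
  refine ⟨(Equiv.ofBijective _ hb).symm.trans (S.val.mapEquiv f), fun a => ?_⟩
  rw [Equiv.trans_apply, Multiset.mapEquiv_apply]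
  exact congrArg (fun x : S => f x) ((Equiv.ofBijective _ hb).apply_symm_apply a)

/-- The point of the plane of an element of an indexed diagram augmented by the diagonal. -/
def indexedPoint (S : Finset α) (f : α → ℝ × ℝ) : S ⊕ (ℝ × ℕ) → ℝ × ℝ
  | .inl a => f a
  | .inr t => (t.1, t.1)

theorem exists_equiv_augmented (S : Finset α) (f : α → ℝ × ℝ) :
    ∃ e : S ⊕ (ℝ × ℕ) ≃ Augmented (S.val.map f), ∀ x, (e x).point = indexedPoint S f x := by
  classical
  obtain ⟨e, he⟩ := exists_equiv_toType_map S f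
  refine ⟨Equiv.sumCongr e (Equiv.refl _), ?_⟩
  rintro (a | t)
  · exact he a
  · rfl

open Classical in
/-- The label of an element of an augmented diagram: indices in `T` are their own label, an index
`a` outside `T` is labelled by the diagonal point `τ a` of colour `b`, and the copies of each
diagonal point are coloured by parity. -/
noncomputable def label (S T : Finset α) (τ : α → ℝ) (b : Bool) :
    S ⊕ (ℝ × ℕ) → α ⊕ (ℝ × Bool)
  | .inl a => if (a : α) ∈ T then .inl a else .inr (τ a, b)
  | .inr t => .inr (t.1, t.2.bodd)

theorem label_eq_inl {S T : Finset α} {τ : α → ℝ} {b : Bool} {x : S ⊕ (ℝ × ℕ)} {a : α} :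
    label S T τ b x = .inl a ↔ ∃ h : a ∈ S, a ∈ T ∧ x = .inl ⟨a, h⟩ := by
  rcases x with ⟨a', ha'⟩ | t
  · by_cases h : a' ∈ T
    · simp only [label, h, if_true, Sum.inl.injEq, Subtype.mk.injEq]
      constructor
      · rintro rfl
        exact ⟨ha', h, rfl⟩
      · rintro ⟨-, -, h⟩
        exact h
    · simp only [label, h, if_false, Sum.inl.injEq, Subtype.mk.injEq, reduceCtorEq, false_iff]
      rintro ⟨-, h', rfl⟩
      exact h h'
  · simp [label]

theorem label_eq_inr {S T : Finset α} {τ : α → ℝ} {b c : Bool} {x : S ⊕ (ℝ × ℕ)} {t : ℝ}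
    (h : label S T τ b x = .inr (t, c)) :
    (∃ a : S, x = .inl a ∧ (a : α) ∉ T ∧ τ a = t ∧ b = c) ∨ ∃ n, x = .inr (t, n) := by
  rcases x with a | ⟨s, n⟩
  · by_cases ha : (a : α) ∈ T
    · simp [label, ha] at h
    · simp only [label, ha, if_false, Sum.inr.injEq, Prod.mk.injEq] at h
      exact .inl ⟨a, rfl, ha, h⟩
  · simp only [label, Sum.inr.injEq, Prod.mk.injEq] at h
    exact .inr ⟨n, by rw [h.1]⟩

theorem countable_label_fiber (S T : Finset α) (τ : α → ℝ) (b : Bool) (t : ℝ) (c : Bool) :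
    Countable {x // label S T τ b x = .inr (t, c)} := by
  have : (Set.range (Sum.inl : S → S ⊕ (ℝ × ℕ)) ∪
      Set.range (fun n : ℕ => (.inr (t, n) : S ⊕ (ℝ × ℕ)))).Countable :=
    (Set.countable_range _).union (Set.countable_range _)
  refine Set.Countable.to_subtype (this.mono fun x hx => ?_)
  rcases label_eq_inr hx with ⟨a, rfl, -⟩ | ⟨n, rfl⟩
  · exact .inl ⟨a, rfl⟩
  · exact .inr ⟨n, rfl⟩

theorem infinite_label_fiber (S T : Finset α) (τ : α → ℝ) (b : Bool) (t : ℝ) (c : Bool) :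
    Infinite {x // label S T τ b x = .inr (t, c)} := by
  refine Infinite.of_injective
    (fun n : ℕ => (⟨.inr (t, Nat.bit c n), by simp [label]⟩ :
      {x // label S T τ b x = .inr (t, c)})) fun m n h => ?_
  have h' : Nat.bit c m = Nat.bit c n := by simpa using h
  simpa only [Nat.div2_bit] using congrArg Nat.div2 h'

/-- Both labellings have equinumerous fibers: over a common index both are singletons, over any
other index both are empty, and over a coloured diagonal point both are countably infinite, since
the diagonal copies of one parity absorb the finitely many unmatched indices. -/
theorem exists_equiv_label (S T : Finset α) (σ τ : α → ℝ) :
    ∃ e : S ⊕ (ℝ × ℕ) ≃ T ⊕ (ℝ × ℕ), ∀ x, label T S τ false (e x) = label S T σ true x := by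
  have key : ∀ k, Nonempty
      ({x // label S T σ true x = k} ≃ {y // label T S τ false y = k}) := by
    rintro (a | ⟨t, c⟩)
    · by_cases ha : a ∈ S ∧ a ∈ T
      · refine ⟨⟨fun _ => ⟨.inl ⟨a, ha.2⟩, label_eq_inl.2 ⟨ha.2, ha.1, rfl⟩⟩,
          fun _ => ⟨.inl ⟨a, ha.1⟩, label_eq_inl.2 ⟨ha.1, ha.2, rfl⟩⟩, ?_, ?_⟩⟩
        · rintro ⟨x, hx⟩
          obtain ⟨_, -, rfl⟩ := label_eq_inl.1 hx
          rfl
        · rintro ⟨x, hx⟩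
          obtain ⟨_, -, rfl⟩ := label_eq_inl.1 hx
          rfl
      · have h₁ : IsEmpty {x // label S T σ true x = .inl a} :=
          ⟨fun x => by obtain ⟨h, h', -⟩ := label_eq_inl.1 x.2; exact ha ⟨h, h'⟩⟩
        have h₂ : IsEmpty {x // label T S τ false x = .inl a} :=
          ⟨fun x => by obtain ⟨h, h', -⟩ := label_eq_inl.1 x.2; exact ha ⟨h', h⟩⟩
        exact ⟨Equiv.equivOfIsEmpty _ _⟩
    · have := countable_label_fiber S T σ true t c
      have := countable_label_fiber T S τ false t c
      have := infinite_label_fiber S T σ true t c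
      have := infinite_label_fiber T S τ false t c
      exact nonempty_equiv_of_countable
  let e k := Classical.choice (key k)
  exact ⟨Equiv.ofFiberEquiv e, Equiv.ofFiberEquiv_map e⟩

/-- The bottleneck distance of two indexed diagrams is at most `δ` if common indices have points
at distance at most `δ`, and the points of all other indices are that close to the diagonal. -/
theorem bottleneckDist_map_le (S T : Finset α) (f g : α → ℝ × ℝ) (δ : ℝ≥0∞)
    (hST : ∀ a ∈ S, a ∈ T → edist (f a) (g a) ≤ δ)
    (hS : ∀ a ∈ S, a ∉ T → ∃ t : ℝ, edist (f a) (t, t) ≤ δ)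
    (hT : ∀ a ∈ T, a ∉ S → ∃ t : ℝ, edist (t, t) (g a) ≤ δ) :
    bottleneckDist (S.val.map f) (T.val.map g) ≤ δ := by
  have hS' : ∀ a, ∃ t : ℝ, a ∈ S → a ∉ T → edist (f a) (t, t) ≤ δ := fun a => by
    by_cases h : a ∈ S ∧ a ∉ T
    · obtain ⟨t, ht⟩ := hS a h.1 h.2
      exact ⟨t, fun _ _ => ht⟩
    · exact ⟨0, fun h₁ h₂ => absurd ⟨h₁, h₂⟩ h⟩
  have hT' : ∀ a, ∃ t : ℝ, a ∈ T → a ∉ S → edist (t, t) (g a) ≤ δ := fun a => by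
    by_cases h : a ∈ T ∧ a ∉ S
    · obtain ⟨t, ht⟩ := hT a h.1 h.2
      exact ⟨t, fun _ _ => ht⟩
    · exact ⟨0, fun h₁ h₂ => absurd ⟨h₁, h₂⟩ h⟩
  choose σ hσ using hS'
  choose τ hτ using hT'
  obtain ⟨e, he⟩ := exists_equiv_label S T σ τ
  obtain ⟨e₁, he₁⟩ := exists_equiv_augmented S f
  obtain ⟨e₂, he₂⟩ := exists_equiv_augmented T g
  have main : ∀ x, edist (indexedPoint S f x) (indexedPoint T g (e x)) ≤ δ := fun x => by
    have hx := he x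
    rcases hl : label S T σ true x with a | ⟨t, c⟩
    · rw [hl] at hx
      obtain ⟨h₁, h₂, hx₁⟩ := label_eq_inl.1 hl
      obtain ⟨h₃, h₄, hx₂⟩ := label_eq_inl.1 hx
      rw [hx₁] at hx₂ ⊢
      rw [hx₂]
      exact hST a h₁ h₂
    · rw [hl] at hx
      rcases label_eq_inr hl with ⟨a, hx₁, ha, rfl, hc⟩ | ⟨n, hx₁⟩ <;>
      rcases label_eq_inr hx with ⟨a', hx₂, ha', h', hc'⟩ | ⟨n', hx₂⟩ <;>
      rw [hx₁] at hx₂ ⊢ <;> rw [hx₂]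
      -- Two unmatched off-diagonal points never meet: those of `S` have colour `true`, those of `T`
      -- colour `false`.
      · rw [← hc] at hc'
        cases hc'
      · exact hσ a a.2 ha
      · have := hτ a' a'.2 ha'
        rw [h'] at this
        exact this
      · simp [indexedPoint]
  refine iInf_le_of_le ((e₁.symm.trans e).trans e₂) (iSup_le fun x => ?_)
  have h := main (e₁.symm x)
  rw [← he₁, ← he₂, Equiv.apply_symm_apply] at h
  exact h

end Bottleneck

/-! ### Extrema of intersections of lower and upper sets of reals. -/

section Interval

/-- If every element of `A` is approached from above by `B` up to `ε`, so is the supremum. -/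
theorem csSup_le_csSup_add {A B : Set ℝ} {ε : ℝ} (hA : A.Nonempty) (hB : BddAbove B)
    (h : ∀ a ∈ A, ∃ b ∈ B, a ≤ b + ε) : sSup A ≤ sSup B + ε :=
  csSup_le hA fun a ha => by
    obtain ⟨b, hb, hab⟩ := h a ha
    have := le_csSup hB hb
    linarith

/-- If every element of `A` is approached from below by `B` up to `ε`, so is the infimum. -/
theorem csInf_le_csInf_add {A B : Set ℝ} {ε : ℝ} (hA : A.Nonempty) (hB : BddBelow B)
    (h : ∀ a ∈ A, ∃ b ∈ B, b ≤ a + ε) : sInf B ≤ sInf A + ε := by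
  have : sInf B - ε ≤ sInf A := le_csInf hA fun a ha => by
    obtain ⟨b, hb, hab⟩ := h a ha
    have := csInf_le hB hb
    linarith
  linarith

/-- Beyond a common point, all of `J` lies in the upper set `K`, so intersecting can only discard
low elements of `J`. -/
theorem csSup_lower_inter_upper {J K : Set ℝ} (hK : IsUpperSet K) (hJb : BddAbove J)
    (hne : (J ∩ K).Nonempty) : sSup (J ∩ K) = sSup J := by
  obtain ⟨t, htJ, htK⟩ := hne
  refine le_antisymm (csSup_le_csSup hJb ⟨t, htJ, htK⟩ Set.inter_subset_left) ?_
  refine csSup_le ⟨t, htJ⟩ fun s hs => ?_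
  have hb : BddAbove (J ∩ K) := hJb.mono Set.inter_subset_left
  rcases le_total s t with h | h
  · exact h.trans (le_csSup hb ⟨htJ, htK⟩)
  · exact le_csSup hb ⟨hs, hK h htK⟩

theorem csInf_lower_inter_upper {J K : Set ℝ} (hJ : IsLowerSet J) (hKb : BddBelow K)
    (hne : (J ∩ K).Nonempty) : sInf (J ∩ K) = sInf K := by
  obtain ⟨t, htJ, htK⟩ := hne
  refine le_antisymm ?_ (csInf_le_csInf hKb ⟨t, htJ, htK⟩ Set.inter_subset_right)
  refine le_csInf ⟨t, htK⟩ fun s hs => ?_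
  have hb : BddBelow (J ∩ K) := hKb.mono Set.inter_subset_right
  rcases le_total t s with h | h
  · exact (csInf_le hb ⟨htJ, htK⟩).trans h
  · exact csInf_le hb ⟨hJ h htJ, hs⟩

/-- A lower and an upper set of reals whose extrema strictly overlap meet in more than a point. -/
theorem csInf_lt_csSup_inter {J K : Set ℝ} (hJ : IsLowerSet J) (hK : IsUpperSet K)
    (hJne : J.Nonempty) (hKne : K.Nonempty) (hJb : BddAbove J) (hKb : BddBelow K)
    (h : sInf K < sSup J) : (J ∩ K).Nonempty ∧ sInf (J ∩ K) < sSup (J ∩ K) := by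
  obtain ⟨j, hj, hjK⟩ := exists_lt_of_lt_csSup hJne h
  obtain ⟨k, hk, hkj⟩ := exists_lt_of_csInf_lt hKne hjK
  have hne : (J ∩ K).Nonempty := ⟨j, hj, hK hkj.le hk⟩
  refine ⟨hne, ?_⟩
  rwa [csSup_lower_inter_upper hK hJb hne, csInf_lower_inter_upper hJ hKb hne]

end Interval

/-! ### Morse sets as classes of mutual reachability between points. -/

section Reachability

variable {X : Type*} [PartialOrder X]

namespace MultivectorField

variable (𝒱 : MultivectorField X)

/-- There is an arrow from the multivector of `x` to some multivector witnessed by `x` and `y`. -/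
def Step (x y : X) : Prop := 𝒱.toSetoid x y ∨ y ≤ x

/-- The elements `x` and `y` are reachable from each other. -/
def Mutual (x y : X) : Prop :=
  Relation.ReflTransGen 𝒱.Step x y ∧ Relation.ReflTransGen 𝒱.Step y x

variable {𝒱} in
theorem Mutual.symm {x y : X} (h : 𝒱.Mutual x y) : 𝒱.Mutual y x := ⟨h.2, h.1⟩

variable {𝒱} in
theorem Mutual.trans {x y z : X} (h : 𝒱.Mutual x y) (h' : 𝒱.Mutual y z) : 𝒱.Mutual x z :=
  ⟨h.1.trans h'.1, h'.2.trans h.2⟩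

theorem Mutual.refl (x : X) : 𝒱.Mutual x x := ⟨.refl, .refl⟩

variable {𝒱} in
theorem Mutual.mono {𝒲 : MultivectorField X}
    (h : ∀ x y, 𝒱.toSetoid x y → 𝒲.toSetoid x y) {x y : X} (hxy : 𝒱.Mutual x y) :
    𝒲.Mutual x y :=
  have hs : 𝒱.Step ≤ 𝒲.Step := fun _ _ => Or.imp_left (h _ _)
  ⟨Relation.ReflTransGen.mono hs _ _ hxy.1, Relation.ReflTransGen.mono hs _ _ hxy.2⟩

/-- The multivector containing `x`. -/
def block (x : X) : 𝒱.multivectors := ⟨{y | 𝒱.toSetoid y x}, 𝒱.toSetoid.mem_classes x⟩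

theorem mem_block (x : X) : x ∈ (𝒱.block x : Set X) := 𝒱.toSetoid.refl x

variable {𝒱}

theorem rel_of_mem {A : 𝒱.multivectors} {x y : X} (hx : x ∈ (A : Set X))
    (hy : y ∈ (A : Set X)) : 𝒱.toSetoid x y := by
  obtain ⟨A, z, rfl⟩ := A
  exact 𝒱.toSetoid.trans hx (𝒱.toSetoid.symm hy)

theorem eq_block {A : 𝒱.multivectors} {x : X} (hx : x ∈ (A : Set X)) : A = 𝒱.block x :=
  Subtype.ext <| by
    obtain ⟨A, z, rfl⟩ := A
    exact Set.ext fun y => ⟨fun hy => 𝒱.toSetoid.trans hy (𝒱.toSetoid.symm hx),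
      fun hy => 𝒱.toSetoid.trans hy hx⟩

/-- An arrow between blocks unfolds into moves inside a block and at most one descent to a face, so
paths of blocks can be replaced by paths of points. -/
theorem reaches_block_iff {x y : X} :
    𝒱.Reaches (𝒱.block x) (𝒱.block y) ↔ Relation.ReflTransGen 𝒱.Step x y := by
  constructor
  -- Reaching every point of the last block lets the induction start the next arrow at whichever
  -- point witnesses it.
  · suffices H : ∀ B, 𝒱.Reaches (𝒱.block x) B →
        ∀ y ∈ (B : Set X), Relation.ReflTransGen 𝒱.Step x y from
      fun h => H _ h y (𝒱.mem_block y)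
    intro B h
    induction h with
    | refl => exact fun y hy => .single (.inl (rel_of_mem (𝒱.mem_block x) hy))
    | tail _ hadj ih =>
      intro y hy
      obtain ⟨z, hz, hz' | ⟨a, ha, hza⟩⟩ := hadj
      · exact (ih z hz').tail (.inl (rel_of_mem hz hy))
      · exact ((ih a ha).tail (.inr hza)).tail (.inl (rel_of_mem hz hy))
  · intro h
    induction h with
    | refl => exact .refl
    | @tail z y _ hs ih =>
      refine ih.tail ?_
      rcases hs with hs | hs
      · exact ⟨y, 𝒱.mem_block y, .inl (𝒱.toSetoid.symm hs)⟩
      · exact ⟨y, 𝒱.mem_block y, .inr ⟨z, 𝒱.mem_block z, hs⟩⟩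

theorem mem_iUnion_scc_block {x y : X} :
    y ∈ ⋃ B ∈ 𝒱.scc (𝒱.block x), (B : Set X) ↔ 𝒱.Mutual x y := by
  simp only [Set.mem_iUnion, exists_prop]
  constructor
  · rintro ⟨B, ⟨h₁, h₂⟩, hy⟩
    rw [eq_block hy] at h₁ h₂
    exact ⟨reaches_block_iff.1 h₁, reaches_block_iff.1 h₂⟩
  · exact fun h => ⟨𝒱.block y, ⟨reaches_block_iff.2 h.1, reaches_block_iff.2 h.2⟩, 𝒱.mem_block y⟩

/-- The Morse sets are the classes of mutual reachability. -/
theorem mem_morseSets_iff {M : Set X} :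
    M ∈ 𝒱.morseSets ↔ M.Nonempty ∧ (∀ x ∈ M, ∀ y ∈ M, 𝒱.Mutual x y) ∧
      ∀ x ∈ M, ∀ y, 𝒱.Mutual x y → y ∈ M := by
  constructor
  · rintro ⟨A, rfl⟩
    obtain ⟨x, hx⟩ : (A : Set X).Nonempty := by
      obtain ⟨A, z, rfl⟩ := A
      exact ⟨z, 𝒱.toSetoid.refl z⟩
    rw [eq_block hx]
    simp only [mem_iUnion_scc_block]
    exact ⟨⟨x, mem_iUnion_scc_block.2 (Mutual.refl 𝒱 x)⟩,
      fun y hy z hz => hy.symm.trans hz, fun y hy z hz => hy.trans hz⟩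
  · rintro ⟨⟨x, hx⟩, h₁, h₂⟩
    refine ⟨𝒱.block x, Set.ext fun y => ?_⟩
    rw [mem_iUnion_scc_block]
    exact ⟨h₁ x hx y, h₂ x hx y⟩

end MultivectorField

end Reachability

/-! ### Lifespans under perturbation of the relation matrix. -/

section Stability

universe u

variable {V : Type u} {G : SimpleGraph V} {W W' : Matrix V V ℝ}

/-- More active relations give a coarser partition, hence more steps. This serves both for one
matrix at two thresholds and for two close matrices at shifted thresholds. -/
theorem mutual_field_mono {s t : ℝ} (h : ∀ i j, W i j > t → W' i j > s) {x y : Cell G}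
    (hxy : (field G W t).Mutual x y) : (field G W' s).Mutual x y :=
  have hm : Merge G W t ≤ Merge G W' s :=
    fun _ _ ⟨i, j, hij, hW, hx, hy⟩ => ⟨i, j, hij, h i j hW, hx, hy⟩
  hxy.mono fun _ _ => Relation.EqvGen.mono hm _ _

variable (G W) in
/-- The thresholds at which `M` is mutually reachable. -/
noncomputable def connectedAt (M : Set (Cell G)) : Set ℝ :=
  {t | t ≤ sSup (critical W) ∧ ∀ x ∈ M, ∀ y ∈ M, (field G W t).Mutual x y}

variable (G W) in
/-- The thresholds at which `M` is a union of classes of mutual reachability. -/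
noncomputable def isolatedAt (M : Set (Cell G)) : Set ℝ :=
  {t | sInf (critical W) ≤ t ∧ ∀ x ∈ M, ∀ y, (field G W t).Mutual x y → y ∈ M}

/-- The upper end of the threshold interval is charged to `connectedAt` and the lower end to
`isolatedAt`, which keeps each of them monotone. -/
theorem lifespan_eq {M : Set (Cell G)} (hM : M.Nonempty) :
    lifespan G W M = connectedAt G W M ∩ isolatedAt G W M := by
  ext t
  simp only [lifespan, thresholds, connectedAt, isolatedAt, MultivectorField.mem_morseSets_iff,
    Set.mem_ofPred_eq, Set.mem_inter_iff, Set.mem_Icc, hM, true_and]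
  tauto

theorem isLowerSet_connectedAt (M : Set (Cell G)) : IsLowerSet (connectedAt G W M) :=
  fun _ _ hst h => ⟨hst.trans h.1, fun x hx y hy =>
    mutual_field_mono (fun _ _ hW => lt_of_le_of_lt hst hW) (h.2 x hx y hy)⟩

theorem isUpperSet_isolatedAt (M : Set (Cell G)) : IsUpperSet (isolatedAt G W M) :=
  fun _ _ hst h => ⟨h.1.trans hst, fun x hx y hy =>
    h.2 x hx y (mutual_field_mono (fun _ _ hW => lt_of_le_of_lt hst hW) hy)⟩

theorem bddAbove_connectedAt (M : Set (Cell G)) : BddAbove (connectedAt G W M) :=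
  ⟨_, fun _ h => h.1⟩

theorem bddBelow_isolatedAt (M : Set (Cell G)) : BddBelow (isolatedAt G W M) :=
  ⟨_, fun _ h => h.1⟩

/-- The entries of the two matrices differ by at most `ε`. -/
def EntrywiseClose (ε : ℝ) (W W' : Matrix V V ℝ) : Prop := ∀ i j, |W i j - W' i j| ≤ ε

theorem EntrywiseClose.symm {ε : ℝ} (h : EntrywiseClose ε W W') : EntrywiseClose ε W' W :=
  fun i j => abs_sub_comm (W i j) (W' i j) ▸ h i j

theorem entrywiseClose_of_supDist_le [Finite V] {ε : ℝ} (h : supDist W W' ≤ ε) :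
    EntrywiseClose ε W W' := fun i j =>
  (le_ciSup (f := fun p : V × V => |W p.1 p.2 - W' p.1 p.2|)
    (Set.finite_range _).bddAbove (i, j)).trans h

theorem finite_critical [Finite V] : (critical W).Finite :=
  (Set.finite_range fun p : V × V => W p.1 p.2).subset fun _ ⟨i, j, _, h⟩ => ⟨(i, j), h⟩

theorem EntrywiseClose.critical_extrema [Finite V] {ε : ℝ} (h : EntrywiseClose ε W W')
    (hε : 0 ≤ ε) : sSup (critical W) ≤ sSup (critical W') + ε ∧
      sInf (critical W') ≤ sInf (critical W) + ε := by
  -- With no off-diagonal entries both critical sets are empty, and their extrema take the default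
  -- value `0`.
  rcases (critical W).eq_empty_or_nonempty with h₁ | h₁
  · have h₂ : critical W' = ∅ := by
      refine Set.eq_empty_of_forall_notMem fun t ⟨i, j, hij, _⟩ => ?_
      exact (h₁ ▸ ⟨i, j, hij, rfl⟩ : W i j ∈ (∅ : Set ℝ))
    simp [h₁, h₂, hε]
  · constructor
    · refine csSup_le_csSup_add h₁ finite_critical.bddAbove ?_
      rintro _ ⟨i, j, hij, rfl⟩
      exact ⟨_, ⟨i, j, hij, rfl⟩, by linarith [(abs_le.1 (h i j)).2]⟩
    · refine csInf_le_csInf_add h₁ finite_critical.bddBelow ?_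
      rintro _ ⟨i, j, hij, rfl⟩
      exact ⟨_, ⟨i, j, hij, rfl⟩, by linarith [(abs_le.1 (h i j)).1]⟩

/-- A relation active for `W` at `t` is active for `W'` at `t - ε`, so connections survive the
shift; the bound by the largest critical value shifts along. -/
theorem EntrywiseClose.sub_mem_connectedAt [Finite V] {ε : ℝ} (h : EntrywiseClose ε W W')
    (hε : 0 ≤ ε) {M : Set (Cell G)} {t : ℝ} (ht : t ∈ connectedAt G W M) :
    t - ε ∈ connectedAt G W' M := by
  refine ⟨by linarith [ht.1, (h.critical_extrema hε).1], fun x hx y hy => ?_⟩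
  exact mutual_field_mono (fun i j hW => by linarith [(abs_le.1 (h i j)).2]) (ht.2 x hx y hy)

theorem EntrywiseClose.add_mem_isolatedAt [Finite V] {ε : ℝ} (h : EntrywiseClose ε W W')
    (hε : 0 ≤ ε) {M : Set (Cell G)} {t : ℝ} (ht : t ∈ isolatedAt G W M) :
    t + ε ∈ isolatedAt G W' M := by
  refine ⟨by linarith [ht.1, (h.critical_extrema hε).2], fun x hx y hy => ht.2 x hx y ?_⟩
  exact mutual_field_mono (fun i j hW => by linarith [(abs_le.1 (h i j)).1]) hy

theorem nonempty_of_mem_persistentMorseSets {M : Set (Cell G)}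
    (hM : M ∈ persistentMorseSets G W) : M.Nonempty := by
  obtain ⟨t, -, ht⟩ := hM.1
  exact (MultivectorField.mem_morseSets_iff.1 ht).1

theorem nonempty_inter_of_mem_persistentMorseSets {M : Set (Cell G)}
    (hM : M ∈ persistentMorseSets G W) :
    (connectedAt G W M ∩ isolatedAt G W M).Nonempty := by
  rw [← lifespan_eq (nonempty_of_mem_persistentMorseSets hM)]
  exact hM.1

theorem birth_eq {M : Set (Cell G)} (hM : M ∈ persistentMorseSets G W) :
    birth G W M = sSup (connectedAt G W M) := by
  rw [birth, lifespan_eq (nonempty_of_mem_persistentMorseSets hM)]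
  exact csSup_lower_inter_upper (isUpperSet_isolatedAt M) (bddAbove_connectedAt M)
    (nonempty_inter_of_mem_persistentMorseSets hM)

theorem death_eq {M : Set (Cell G)} (hM : M ∈ persistentMorseSets G W) :
    death G W M = sInf (isolatedAt G W M) := by
  rw [death, lifespan_eq (nonempty_of_mem_persistentMorseSets hM)]
  exact csInf_lower_inter_upper (isLowerSet_connectedAt M) (bddBelow_isolatedAt M)
    (nonempty_inter_of_mem_persistentMorseSets hM)

/-- The extrema bounding the lifetime of a persistent Morse set move by at most `ε`, in the
direction that shortens the lifetime. -/
theorem EntrywiseClose.birth_le_and_le_death [Finite V] {ε : ℝ} (h : EntrywiseClose ε W W')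
    (hε : 0 ≤ ε) {M : Set (Cell G)} (hM : M ∈ persistentMorseSets G W) :
    birth G W M ≤ sSup (connectedAt G W' M) + ε ∧
      sInf (isolatedAt G W' M) ≤ death G W M + ε := by
  obtain ⟨t, htJ, htK⟩ := nonempty_inter_of_mem_persistentMorseSets hM
  rw [birth_eq hM, death_eq hM]
  exact ⟨csSup_le_csSup_add ⟨t, htJ⟩ (bddAbove_connectedAt M)
      fun s hs => ⟨s - ε, h.sub_mem_connectedAt hε hs, by linarith⟩,
    csInf_le_csInf_add ⟨t, htK⟩ (bddBelow_isolatedAt M)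
      fun s hs => ⟨s + ε, h.add_mem_isolatedAt hε hs, le_rfl⟩⟩

/-- A Morse set that persists only for the first of two close matrices has a short lifetime. -/
theorem EntrywiseClose.birth_sub_death_le [Finite V] {ε : ℝ} (h : EntrywiseClose ε W W')
    (hε : 0 ≤ ε) {M : Set (Cell G)} (hM : M ∈ persistentMorseSets G W)
    (hM' : M ∉ persistentMorseSets G W') : birth G W M - death G W M ≤ 2 * ε := by
  obtain ⟨t, htJ, htK⟩ := nonempty_inter_of_mem_persistentMorseSets hM
  -- A strict overlap would give `M` a lifespan of positive length for `W'`. Each of the two extrema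
  -- then costs one `ε`, whence `2 * ε`.
  have hle : sSup (connectedAt G W' M) ≤ sInf (isolatedAt G W' M) := by
    by_contra! hlt
    refine hM' ?_
    rw [persistentMorseSets, Set.mem_ofPred_eq, death, birth,
      lifespan_eq (nonempty_of_mem_persistentMorseSets hM)]
    exact csInf_lt_csSup_inter (isLowerSet_connectedAt M) (isUpperSet_isolatedAt M)
      ⟨_, h.sub_mem_connectedAt hε htJ⟩ ⟨_, h.add_mem_isolatedAt hε htK⟩
      (bddAbove_connectedAt M) (bddBelow_isolatedAt M) hlt
  have := h.birth_le_and_le_death hε hM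
  linarith

theorem edist_le_ofReal_of_abs_le {ε : ℝ} {p q : ℝ × ℝ} (h₁ : |p.1 - q.1| ≤ ε)
    (h₂ : |p.2 - q.2| ≤ ε) : edist p q ≤ ENNReal.ofReal ε := by
  rw [edist_dist]
  exact ENNReal.ofReal_le_ofReal (max_le h₁ h₂)

/-- A point of height at most `2 * ε` over the diagonal is `ε`-close to it. -/
theorem edist_diagonal_le {ε b d : ℝ} (hdb : d ≤ b) (h : b - d ≤ 2 * ε) :
    edist ((b, d) : ℝ × ℝ) ((b + d) / 2, (b + d) / 2) ≤ ENNReal.ofReal ε := by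
  apply edist_le_ofReal_of_abs_le <;> rw [abs_le] <;> constructor <;> dsimp only <;> linarith

end Stability

end MorsePersistence

open MorsePersistence in
theorem mainTheorem1 {V : Type*} [Finite V] (G : SimpleGraph V) (W W' : Matrix V V ℝ) (ε : ℝ)
    (hε : MorsePersistence.supDist W W' ≤ ε) :
    MorsePersistence.bottleneckDist (MorsePersistence.morseDiagram G W)
      (MorsePersistence.morseDiagram G W') ≤ ENNReal.ofReal ε := by
  -- This covers an empty `V` too, where the supremum is `0`.
  have hε₀ : 0 ≤ ε := (Real.iSup_nonneg fun _ => abs_nonneg _).trans hε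
  have h := entrywiseClose_of_supDist_le hε
  unfold morseDiagram
  refine bottleneckDist_map_le _ _ _ _ _ (fun M hM hM' => ?_) (fun M hM hM' => ?_)
    (fun M hM hM' => ?_) <;> rw [Set.Finite.mem_toFinset] at hM hM'
  -- Each direction bounds births and deaths on one side only; persistence for both matrices allows
  -- the roles to be exchanged for the other side.
  · have h₁ := h.birth_le_and_le_death hε₀ hM
    have h₂ := h.symm.birth_le_and_le_death hε₀ hM'
    rw [← birth_eq hM', ← death_eq hM'] at h₁
    rw [← birth_eq hM, ← death_eq hM] at h₂
    apply edist_le_ofReal_of_abs_le <;> rw [abs_le] <;> constructor <;> dsimp only <;> linarith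
  · exact ⟨_, edist_diagonal_le hM.2.le (h.birth_sub_death_le hε₀ hM hM')⟩
  · refine ⟨_, (edist_comm _ _).trans_le
      (edist_diagonal_le hM.2.le (h.symm.birth_sub_death_le hε₀ hM hM'))⟩
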